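/- Let $\Gamma$ be a finite simplicial graph with vertex set $V(\Gamma)$, edge set $E(\Gamma)$ and edge labeling $m\colon E(\Gamma)\to\{2,3,4,\dots\}$, and let $$A_\Gamma=\Big\langle V(\Gamma)\ \Big|\ \underbrace{vwv\cdots}_{m(\{v,w\})\text{ letters}}=\underbrace{wvw\cdots}_{m(\{v,w\})\text{ letters}}\ \text{ whenever } \{v,w\}\in E(\Gamma)\Big\rangle$$ be the associated Artin group. For an induced subgraph $\Omega$ of $\Gamma$ let $A_\Omega\le A_\Gamma$ be the subgroup generated by $V(\Omega)$; a parabolic subgroup of $A_\Gamma$ is a subgroup of the form $gA_\Omega g^{-1}$ with $g\in A_\Gamma$. Let $\Omega,\Delta$ be induced subgraphs of $\Gamma$ and let $g,h\in A_\Gamma$ be such that $gA_\Omega g^{-1}\subseteq hA_\Delta h^{-1}$. Then $|V(\Omega)|\le|V(\Delta)|$ and, if $|V(\Omega)|=|V(\Delta)|$, then $gA_\Omega g^{-1}=hA_\Delta h^{-1}$. -/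

import Mathlib

universe u

/-- A simplicial graph with vertex set `V` (simple, undirected) together with an edge labeling
`m : E → {2, 3, 4, …}`. -/
structure LabeledGraph (V : Type u) where
  /-- the underlying simple graph -/
  graph : SimpleGraph V
  /-- the labeling of the edges -/
  label : graph.edgeSet → ℕ
  /-- the labels are at least two -/
  two_le_label : ∀ e, 2 ≤ label e

namespace LabeledGraph

variable {V : Type u}

/-- The alternating word `v w v w ⋯` with exactly `n` letters and first letter `v`,
as an element of the free group on `V`. -/
def altWord : V → V → ℕ → FreeGroup V
  | _, _, 0 => 1
  | v, w, n + 1 => FreeGroup.of v * altWord w v n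

/-- The relators `(v w v ⋯) (w v w ⋯)⁻¹`, both words having `m({v, w})` letters, one for each
edge `{v, w}` and each order of its two end points. -/
def artinRelators (Γ : LabeledGraph V) : Set (FreeGroup V) :=
  {r | ∃ (v w : V) (h : s(v, w) ∈ Γ.graph.edgeSet),
    r = altWord v w (Γ.label ⟨s(v, w), h⟩) * (altWord w v (Γ.label ⟨s(v, w), h⟩))⁻¹}

/-- The Artin group of a labeled graph. -/
abbrev ArtinGroup (Γ : LabeledGraph V) : Type u :=
  PresentedGroup Γ.artinRelators

/-- The standard generator of the Artin group attached to a vertex. -/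
def artinGen (Γ : LabeledGraph V) (v : V) : Γ.ArtinGroup :=
  PresentedGroup.of v

/-- The standard parabolic subgroup generated by a set `X` of vertices, that is, by the vertices
of the induced subgraph on `X`. -/
def standardParabolic (Γ : LabeledGraph V) (X : Set V) : Subgroup Γ.ArtinGroup :=
  Subgroup.closure (Γ.artinGen '' X)

/-- The parabolic subgroup obtained by conjugating (`x ↦ g x g⁻¹`) the standard parabolic subgroup
on `X` by `g`. -/
def parabolic (Γ : LabeledGraph V) (g : Γ.ArtinGroup) (X : Set V) : Subgroup Γ.ArtinGroup :=
  (Γ.standardParabolic X).map (MulAut.conj g).toMonoidHom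

end LabeledGraph

/-! Let W be the Coxeter group of Γ and let M_X be the set of shortest representatives of the cosets
wW_X. The Artin group A acts on M_X × A as follows: a generator v sends (w, a) to (w, xa) if s_v w =
w s_x with x ∈ X, and to (s_v w, a) otherwise. The action commutes with right multiplication on A,
emits only letters of X, and on (1, c) an element of A_X acts by left multiplication.

Suppose g⁻¹ A_Y g ≤ A_X and g(1, 1) = (w, b). For y ∈ Y, writing yg = g(g⁻¹yg) gives y(w, b) = (w, b
g⁻¹yg). Since s_y w ≠ w, this must be an emission: s_y w = w s_x and g⁻¹yg = b⁻¹xb with b ∈ A_X.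
Thus y ↦ x is an injection Y → X, and if it is onto then g⁻¹ A_Y g = b⁻¹ A_X b = A_X.

The work lies in the braid relations for this action (`altProd_retractStep_comm`). For a fixed w,
either at most one s_x is conjugated by w into the dihedral group W_{i,j}, and its emissions are
counted by inversions, or two are, and then w carries them exactly to s_i and s_j
(`conj_simple_eq_of_mem_minReps`). This needs the exact orders of products of simple reflections,
and the exchange condition. -/

/-! ### The geometric representation and the orders of products of two simple reflections -/

theorem CoxeterMatrix.sin_two_mul_pi_div_ne_zero {m : ℕ} (hm : 3 ≤ m) :
    Real.sin (2 * (Real.pi / m)) ≠ 0 := by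
  have hm' : (3 : ℝ) ≤ m := by exact_mod_cast hm
  apply ne_of_gt
  apply Real.sin_pos_of_pos_of_lt_pi
  · positivity
  · rw [← mul_div_assoc, div_lt_iff₀ (by linarith)]
    nlinarith [Real.pi_pos]

namespace CoxeterMatrix

variable {B : Type*} (M : CoxeterMatrix B)

/-- The linear form `x ↦ 2 ⟨α_i, x⟩` of the standard geometric representation. -/
noncomputable def rootForm (i : B) : Module.Dual ℝ (B →₀ ℝ) :=
  Finsupp.linearCombination ℝ fun j => -2 * Real.cos (Real.pi / M i j)

theorem rootForm_single (i j : B) :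
    M.rootForm i (Finsupp.single j 1) = -2 * Real.cos (Real.pi / M i j) := by
  simp [rootForm]

theorem rootForm_single_self (i : B) : M.rootForm i (Finsupp.single i 1) = 2 := by
  simp [rootForm_single]

/-- The reflection of the standard geometric representation attached to a simple reflection. -/
noncomputable def geometricReflection (i : B) : (B →₀ ℝ) ≃ₗ[ℝ] (B →₀ ℝ) :=
  Module.reflection (M.rootForm_single_self i)

open Polynomial Polynomial.Chebyshev

theorem rootForm_mul_rootForm (i j : B) :
    M.rootForm i (Finsupp.single j 1) * M.rootForm j (Finsupp.single i 1) - 2 =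
      2 * Real.cos (2 * (Real.pi / M i j)) := by
  rw [rootForm_single, rootForm_single, M.symmetric j i, Real.cos_two_mul]; ring

theorem S_eval_mul_sin (i j : B) (n : ℤ) :
    (S ℝ n).eval (2 * Real.cos (2 * (Real.pi / M i j))) * Real.sin (2 * (Real.pi / M i j)) =
      Real.sin ((n + 1) * (2 * (Real.pi / M i j))) :=
  S_two_mul_real_cos _ _

/-- Powers of a product of two reflections have coefficients in the Chebyshev polynomials S_n at 2
cos θ, where θ = 2π/m. The identity S_n(2 cos θ) sin θ = sin((n+1)θ) makes them vanish at the
exponent m when m ≥ 3; for m = 2 the factor sin θ is zero, so that case is computed directly. -/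
theorem isLiftable_geometricReflection : M.IsLiftable M.geometricReflection := by
  intro i j
  ext1 z
  rcases lt_trichotomy (M i j) 2 with h | h | h
  · by_cases h0 : M i j = 0
    · simp [h0]
    · have h1 : M i j = 1 := by omega
      have : i = j := by
        by_contra hne
        exact M.off_diagonal i j hne h1
      subst this
      rw [h1, pow_one]
      exact Module.involutive_reflection (M.rootForm_single_self i) z
  · have hij : M.rootForm i (Finsupp.single j 1) = 0 := by simp [rootForm_single, h]
    have hji : M.rootForm j (Finsupp.single i 1) = 0 := by simp [rootForm_single, M.symmetric j i, h]
    have hii := M.rootForm_single_self i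
    have hjj := M.rootForm_single_self j
    rw [h, pow_two]
    simp only [LinearEquiv.mul_apply, geometricReflection, Module.reflection_apply, map_sub,
      map_smul, hij, hji, hii, hjj, LinearEquiv.coe_one, id]
    module
  · have hs := sin_two_mul_pi_div_ne_zero (m := M i j) (by omega)
    have h0 : (M i j : ℝ) ≠ 0 := by
      have : M i j ≠ 0 := by omega
      exact_mod_cast this
    unfold geometricReflection
    rw [Module.reflection_mul_reflection_pow_apply _ _ _ _ _ (M.rootForm_mul_rootForm i j).symm]
    -- For m = 2p the vanishing factor is S_{p-1}, because pθ = π; for m = 2p + 1 it is S_p +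
    -- S_{p-1}, because pθ = 2π - (p+1)θ.
    rcases Nat.even_or_odd' (M i j) with ⟨p, hp | hp⟩
    · have e1 : ((M i j : ℤ) - 2) / 2 = p - 1 := by omega
      have e2 : ((M i j : ℤ) - 1) / 2 = p - 1 := by omega
      have hS : (S ℝ (p - 1)).eval (2 * Real.cos (2 * (Real.pi / M i j))) = 0 := by
        have := M.S_eval_mul_sin i j (p - 1)
        have e : (((p - 1 : ℤ) : ℝ) + 1) * (2 * (Real.pi / M i j)) = Real.pi := by
          have : (M i j : ℝ) = 2 * p := by exact_mod_cast hp
          push_cast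
          field_simp
          rw [this]; ring
        rw [e, Real.sin_pi] at this
        exact (mul_eq_zero.1 this).resolve_right hs
      rw [e1, e2, hS]
      simp
    · have e1 : ((M i j : ℤ) - 3) / 2 = p - 1 := by omega
      have e2 : ((M i j : ℤ) - 1) / 2 = p := by omega
      have e3 : (M i j : ℤ) / 2 = p := by omega
      have e4 : ((M i j : ℤ) - 2) / 2 = p - 1 := by omega
      have hS : (S ℝ p).eval (2 * Real.cos (2 * (Real.pi / M i j))) +
          (S ℝ (p - 1)).eval (2 * Real.cos (2 * (Real.pi / M i j))) = 0 := by
        have h1 := M.S_eval_mul_sin i j (p - 1)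
        have h2 := M.S_eval_mul_sin i j p
        have e : (((p - 1 : ℤ) : ℝ) + 1) * (2 * (Real.pi / M i j)) =
            2 * Real.pi - (((p : ℤ) : ℝ) + 1) * (2 * (Real.pi / M i j)) := by
          have : (M i j : ℝ) = 2 * p + 1 := by exact_mod_cast hp
          push_cast
          field_simp
          rw [this]; ring
        rw [e, Real.sin_two_pi_sub] at h1
        exact (mul_eq_zero.1 (by rw [add_mul, h1, h2]; ring : _ * _ = (0 : ℝ))).resolve_right hs
      rw [e1, e2, e3, e4, hS]
      simp

/-- Compare the coordinates of the image of α_i with those of α_i. For m ≥ 3 they give S_{k-1} = 0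
and S_k = 1, hence cos kθ = 1 and kθ ∈ 2πℤ. -/
theorem dvd_of_geometricReflection_pow_eq_one {i j : B} (hne : i ≠ j) {k : ℕ}
    (hk : (M.geometricReflection i * M.geometricReflection j) ^ k = 1) : M i j ∣ k := by
  have hk' := LinearEquiv.congr_fun hk (Finsupp.single i 1)
  unfold geometricReflection at hk'
  rw [Module.reflection_mul_reflection_pow_apply_self _ _ _ _ (M.rootForm_mul_rootForm i j).symm]
    at hk'
  have hi := DFunLike.congr_fun hk' i
  have hj := DFunLike.congr_fun hk' j
  simp only [rootForm_single, LinearEquiv.coe_one, id, Finsupp.add_apply, Finsupp.smul_apply,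
    Finsupp.single_eq_same, smul_eq_mul, Finsupp.single_eq_of_ne hne, Finsupp.single_eq_of_ne hne.symm,
    mul_zero, add_zero, zero_add, mul_one] at hi hj
  rw [M.symmetric j i] at hj
  have h1 := M.off_diagonal i j hne
  rcases lt_trichotomy (M i j) 2 with h | h | h
  -- The entry 0 stands for ∞; as `Real.pi / 0 = 0`, the argument is 2 and S_{k-1}(2) = k, which
  -- vanishes only for k = 0.
  · have h0 : M i j = 0 := by omega
    simp [h0] at hj ⊢
    exact hj
  · rw [h]
    have : (2 : ℝ) * Real.cos (2 * (Real.pi / M i j)) = -2 := by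
      rw [h]; push_cast; rw [mul_div_cancel₀ _ (two_ne_zero)]; simp
    rw [this, S_eval_neg_two, S_eval_neg_two] at hi
    by_contra hodd
    have hodd : Odd k := by rwa [← even_iff_two_dvd, Nat.not_even_iff_odd] at hodd
    rw [Int.negOnePow_odd _ (by exact_mod_cast hodd),
      Int.negOnePow_even _ (by simpa using (show Odd (k : ℤ) by exact_mod_cast hodd).sub_odd odd_one)] at hi
    push_cast at hi
    linarith
  · have hs := sin_two_mul_pi_div_ne_zero (m := M i j) (by omega)
    have h0 : (0 : ℝ) < M i j := by
      have : 0 < M i j := by omega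
      exact_mod_cast this
    have hc : Real.cos (Real.pi / M i j) ≠ 0 := by
      intro hc
      rw [Real.sin_two_mul, hc, mul_zero] at hs
      exact hs rfl
    have hS : (S ℝ ((k : ℤ) - 1)).eval (2 * Real.cos (2 * (Real.pi / M i j))) = 0 := by
      rcases mul_eq_zero.1 hj with h | h
      · exact h
      · exact absurd h (by simpa using hc)
    have hS1 := M.S_eval_mul_sin i j (k - 1)
    have hS2 := M.S_eval_mul_sin i j k
    rw [hS, add_zero] at hi
    rw [hS] at hS1
    rw [hi] at hS2
    push_cast at hS1 hS2
    rw [add_mul, Real.sin_add] at hS2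
    simp only [sub_add_cancel, zero_mul, one_mul] at hS1 hS2
    rw [← hS1, zero_mul, zero_add] at hS2
    have hcos : Real.cos ((k : ℝ) * (2 * (Real.pi / M i j))) = 1 := by
      have : (Real.cos ((k : ℝ) * (2 * (Real.pi / M i j))) - 1) * Real.sin (2 * (Real.pi / M i j)) = 0 := by
        linarith
      linarith [(mul_eq_zero.1 this).resolve_right hs]
    obtain ⟨n, hn⟩ := (Real.cos_eq_one_iff _).1 hcos
    have : (n : ℝ) * M i j = k := by
      have hpi := Real.pi_ne_zero
      field_simp at hn
      linarith
    have : (n * M i j : ℤ) = k := by exact_mod_cast this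
    exact_mod_cast Dvd.intro_left n this

end CoxeterMatrix

namespace CoxeterSystem

variable {B W : Type*} [Group W] {M : CoxeterMatrix B} (cs : CoxeterSystem M W)

theorem orderOf_simple_mul_simple (i j : B) : orderOf (cs.simple i * cs.simple j) = M i j := by
  by_cases hij : i = j
  · subst hij; simp
  apply Nat.dvd_antisymm
  · exact orderOf_dvd_of_pow_eq_one (cs.simple_mul_simple_pow i j)
  · apply M.dvd_of_geometricReflection_pow_eq_one hij
    have := congrArg (cs.lift ⟨_, M.isLiftable_geometricReflection⟩)
      (pow_orderOf_eq_one (cs.simple i * cs.simple j))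
    simpa only [map_pow, map_mul, map_one, cs.lift_apply_simple] using this

theorem simple_injective : Function.Injective cs.simple := by
  intro i j h
  by_contra hne
  apply M.off_diagonal i j hne
  rw [← cs.orderOf_simple_mul_simple, h]
  simp

end CoxeterSystem

/-! ### Inversion parity and the exchange condition -/

namespace CoxeterSystem

variable {B W : Type*} [Group W] {M : CoxeterMatrix B} (cs : CoxeterSystem M W)

open Classical in
/-- The action of a simple reflection on pairs consisting of an element of `W` and a sign. -/
noncomputable def signStep (i : B) : Function.End (W × ZMod 2) :=
  fun p => (cs.simple i * p.1 * cs.simple i, p.2 + if p.1 = cs.simple i then 1 else 0)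

-- Read from the right, the inversions of the word (ij)^k are (s_j s_i)^l s_j for l < 2k; the sign
-- counts how many of them equal r.
open Classical in
theorem signStep_mul_signStep_pow (i j : B) (k : ℕ) (r : W) (e : ZMod 2) :
    ((cs.signStep i * cs.signStep j) ^ k) (r, e) =
      ((cs.simple i * cs.simple j) ^ k * r * (cs.simple j * cs.simple i) ^ k,
        e + ∑ l ∈ Finset.range (2 * k),
          if r = (cs.simple j * cs.simple i) ^ l * cs.simple j then 1 else 0) := by
  induction k with
  | zero => simp; rfl
  | succ k ih =>
    have hinv : ∀ n : ℕ, (cs.simple j * cs.simple i) ^ n = ((cs.simple i * cs.simple j) ^ n)⁻¹ := by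
      intro n; rw [← inv_pow]; simp
    have hconj : ∀ n : ℕ, (cs.simple j * cs.simple i) ^ n * cs.simple j =
        cs.simple j * (cs.simple i * cs.simple j) ^ n := by
      intro n
      induction n with
      | zero => simp
      | succ n ih => rw [pow_succ', mul_assoc, ih, pow_succ']; simp only [mul_assoc]
    have h1 : (cs.simple i * cs.simple j) ^ k * r * (cs.simple j * cs.simple i) ^ k = cs.simple j ↔
        r = (cs.simple j * cs.simple i) ^ (2 * k) * cs.simple j := by
      rw [two_mul, pow_add, mul_assoc ((cs.simple j * cs.simple i) ^ k), hconj, hinv]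
      generalize (cs.simple i * cs.simple j) ^ k = q
      rw [mul_inv_eq_iff_eq_mul, ← eq_inv_mul_iff_mul_eq]
    have h2 : cs.simple j * ((cs.simple i * cs.simple j) ^ k * r * (cs.simple j * cs.simple i) ^ k)
          * cs.simple j = cs.simple i ↔
        r = (cs.simple j * cs.simple i) ^ (2 * k + 1) * cs.simple j := by
      have : (cs.simple j * cs.simple i) ^ (2 * k + 1) * cs.simple j =
          (cs.simple j * cs.simple i) ^ k * (cs.simple j * cs.simple i * cs.simple j) *
            (cs.simple i * cs.simple j) ^ k := by
        rw [two_mul, add_right_comm, pow_add, mul_assoc, hconj, ← mul_assoc, pow_succ, hinv]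
        simp only [mul_assoc]
      rw [this, hinv]
      generalize (cs.simple i * cs.simple j) ^ k = q
      constructor
      · intro h
        simp [← h, mul_assoc]
      · rintro rfl
        simp [mul_assoc]
    rw [pow_succ']
    change (cs.signStep i * cs.signStep j) (((cs.signStep i * cs.signStep j) ^ k) (r, e)) = _
    rw [ih, Nat.mul_succ, Finset.sum_range_succ, Finset.sum_range_succ]
    change cs.signStep i (cs.signStep j _) = _
    simp only [signStep, h1, h2]
    rw [pow_succ' (cs.simple i * cs.simple j), pow_succ (cs.simple j * cs.simple i) k]
    simp only [mul_assoc, add_assoc]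

/-- The inversions of (ij)^m repeat with period m, so each is met an even number of times and the
sign is unchanged. -/
theorem isLiftable_signStep : M.IsLiftable cs.signStep := by
  classical
  intro i j
  funext ⟨r, e⟩
  rw [cs.signStep_mul_signStep_pow, two_mul, Finset.sum_range_add]
  have : ∀ l, (cs.simple j * cs.simple i) ^ (M i j + l) = (cs.simple j * cs.simple i) ^ l := by
    intro l; rw [pow_add]; simp
  simp only [this, ← two_mul]
  simp [show (2 : ZMod 2) = 0 from rfl]
  rfl

/-- The parity of the number of occurrences of `r` among the right inversions of any word
for `w`. -/
noncomputable def invParity (w r : W) : ZMod 2 :=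
  (cs.lift ⟨_, cs.isLiftable_signStep⟩ w (r, 0)).2

open Classical in
theorem lift_signStep_apply (w r : W) (e : ZMod 2) :
    cs.lift ⟨_, cs.isLiftable_signStep⟩ w (r, e) = (w * r * w⁻¹, e + cs.invParity w r) := by
  have hmul : ∀ (u v : W) p, cs.lift ⟨_, cs.isLiftable_signStep⟩ (u * v) p =
      cs.lift ⟨_, cs.isLiftable_signStep⟩ u (cs.lift ⟨_, cs.isLiftable_signStep⟩ v p) := by
    intro u v p; rw [map_mul]; rfl
  unfold invParity
  induction w using cs.simple_induction_left generalizing r e with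
  | one => rw [map_one]; simp [Function.End.one_def]
  | mul_simple_left w i ih =>
    rw [hmul, hmul, ih, ih r 0, cs.lift_apply_simple]
    simp [signStep, mul_assoc, add_assoc]

theorem invParity_mul (u w r : W) :
    cs.invParity (u * w) r = cs.invParity w r + cs.invParity u (w * r * w⁻¹) := by
  have : cs.lift ⟨_, cs.isLiftable_signStep⟩ (u * w) (r, 0) =
      cs.lift ⟨_, cs.isLiftable_signStep⟩ u (cs.lift ⟨_, cs.isLiftable_signStep⟩ w (r, 0)) := by
    rw [map_mul]; rfl
  simp only [lift_signStep_apply] at this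
  simpa using congrArg Prod.snd this

theorem invParity_one (r : W) : cs.invParity 1 r = 0 := by
  simp [invParity, Function.End.one_def]

open Classical in
theorem invParity_simple (i : B) (r : W) :
    cs.invParity (cs.simple i) r = if r = cs.simple i then 1 else 0 := by
  unfold invParity
  rw [cs.lift_apply_simple]
  simp [signStep]

/-- Strong exchange: an odd count means that r is the inversion of some letter, and multiplying by
it deletes that letter. -/
theorem exists_eraseIdx_of_invParity_ne_zero (ω : List B) (r : W)
    (h : cs.invParity (cs.wordProd ω) r ≠ 0) :
    ∃ j < ω.length, cs.wordProd ω * r = cs.wordProd (ω.eraseIdx j) := by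
  classical
  induction ω with
  | nil => simp [invParity_one] at h
  | cons i ω ih =>
    rw [cs.wordProd_cons, cs.invParity_mul] at h
    by_cases h0 : cs.invParity (cs.wordProd ω) r = 0
    · rw [h0, zero_add, cs.invParity_simple] at h
      have h1 : cs.wordProd ω * r * (cs.wordProd ω)⁻¹ = cs.simple i := by
        by_contra h1; simp [h1] at h
      refine ⟨0, by simp, ?_⟩
      rw [cs.wordProd_cons, mul_assoc, mul_inv_eq_iff_eq_mul.1 h1]
      simp
    · obtain ⟨j, hj, e⟩ := ih h0
      refine ⟨j + 1, by simpa using hj, ?_⟩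
      rw [cs.wordProd_cons, mul_assoc, e, List.eraseIdx_cons_succ, cs.wordProd_cons]

theorem length_mul_lt_of_invParity_ne_zero (w r : W) (h : cs.invParity w r ≠ 0) :
    cs.length (w * r) < cs.length w := by
  obtain ⟨ω, hω, rfl⟩ := cs.exists_isReduced w
  obtain ⟨j, hj, e⟩ := cs.exists_eraseIdx_of_invParity_ne_zero ω r h
  rw [e, hω.eq]
  refine (cs.length_wordProd_le _).trans_lt ?_
  rw [List.length_eraseIdx_of_lt hj]
  omega

theorem exists_word_of_mem_closure {I : Set B} {d : W}
    (hd : d ∈ Subgroup.closure (cs.simple '' I)) : ∃ ω : List B, (∀ i ∈ ω, i ∈ I) ∧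
      cs.wordProd ω = d := by
  induction hd using Subgroup.closure_induction with
  | mem x hx => obtain ⟨i, hi, rfl⟩ := hx; exact ⟨[i], by simpa using hi, by simp⟩
  | one => exact ⟨[], by simp, by simp⟩
  | mul x y _ _ hx hy =>
    obtain ⟨a, ha, rfl⟩ := hx
    obtain ⟨b, hb, rfl⟩ := hy
    exact ⟨a ++ b, by simpa [or_imp, forall_and] using ⟨ha, hb⟩, cs.wordProd_append a b⟩
  | inv x _ hx =>
    obtain ⟨a, ha, rfl⟩ := hx
    exact ⟨a.reverse, by simpa using ha, cs.wordProd_reverse a⟩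

/-- The last letter of a word for d that is shortest among words in I is a descent: otherwise
exchange deletes two letters, and the result is still a word in I. -/
theorem exists_invParity_ne_zero_of_mem_closure {I : Set B} {d : W}
    (hd : d ∈ Subgroup.closure (cs.simple '' I)) (h1 : d ≠ 1) :
    ∃ i ∈ I, cs.invParity d (cs.simple i) ≠ 0 := by
  classical
  have hex : ∃ n, ∃ ω : List B, ω.length = n ∧ (∀ i ∈ ω, i ∈ I) ∧ cs.wordProd ω = d := by
    obtain ⟨ω, h⟩ := cs.exists_word_of_mem_closure hd
    exact ⟨_, ω, rfl, h⟩
  obtain ⟨ω, hlen, hI, hω⟩ := Nat.find_spec hex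
  rcases List.eq_nil_or_concat' ω with rfl | ⟨ω', i, rfl⟩
  · exact absurd hω.symm (by simpa using h1)
  refine ⟨i, hI i (by simp), fun h0 => ?_⟩
  rw [cs.wordProd_append, cs.wordProd_singleton] at hω
  have h2 : cs.invParity (cs.wordProd ω') (cs.simple i) ≠ 0 := by
    rw [← hω, cs.invParity_mul, cs.invParity_simple] at h0
    intro h; simp [h] at h0
  obtain ⟨j, hj, e⟩ := cs.exists_eraseIdx_of_invParity_ne_zero _ _ h2
  refine Nat.find_min hex (m := (ω'.eraseIdx j).length) ?_
    ⟨_, rfl, fun k hk => hI k (by simp [List.mem_of_mem_eraseIdx hk]), by rw [← e, hω]⟩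
  rw [← hlen, List.length_eraseIdx_of_lt hj, List.length_append]
  simp

/-! ### Shortest coset representatives -/

/-- The elements `w` that are shortest in their cosets `w W_X`. -/
def minReps (X : Set B) : Set W := {w | ∀ x ∈ X, cs.invParity w (cs.simple x) = 0}

theorem one_mem_minReps (X : Set B) : 1 ∈ cs.minReps X := fun _ _ => cs.invParity_one _

theorem simple_mul_mem_minReps {X : Set B} {w : W} (hw : w ∈ cs.minReps X) {i : B}
    (h : ¬∃ x ∈ X, cs.simple i * w = w * cs.simple x) : cs.simple i * w ∈ cs.minReps X := by
  intro x hx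
  rw [cs.invParity_mul, hw x hx, zero_add, cs.invParity_simple, if_neg]
  intro e
  exact h ⟨x, hx, (mul_inv_eq_iff_eq_mul.1 e).symm⟩

/-- Take dw shortest in W_I w; no reflection of W_I then shortens it from the left. If r = dw s_x
(dw)⁻¹ lies in W_I, it has a descent c ∈ I. Computing the parity of r·dw = dw·s_x at (dw)⁻¹ s_c dw
in both ways forces r = s_c. -/
theorem exists_minimal_mul_left (X I : Set B) (w : W) :
    ∃ d ∈ Subgroup.closure (cs.simple '' I),
      (∀ u ∈ Subgroup.closure (cs.simple '' I),
        cs.invParity (d * w) ((d * w)⁻¹ * u * (d * w)) = 0) ∧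
      ∀ x ∈ X, w * cs.simple x * w⁻¹ ∈ Subgroup.closure (cs.simple '' I) →
        ∃ c ∈ I, d * w * cs.simple x * (d * w)⁻¹ = cs.simple c := by
  classical
  have hex : ∃ n, ∃ d ∈ Subgroup.closure (cs.simple '' I), cs.length (d * w) = n :=
    ⟨_, 1, one_mem _, rfl⟩
  obtain ⟨d, hd, hlen⟩ := Nat.find_spec hex
  have hmin : ∀ u ∈ Subgroup.closure (cs.simple '' I),
        cs.invParity (d * w) ((d * w)⁻¹ * u * (d * w)) = 0 := by
    intro u hu
    by_contra h0
    have := cs.length_mul_lt_of_invParity_ne_zero _ _ h0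
    rw [hlen] at this
    refine Nat.find_min hex this ⟨u * d, mul_mem hu hd, ?_⟩
    congr 1
    group
  refine ⟨d, hd, hmin, fun x hx hxI => ?_⟩
  have hr : d * w * cs.simple x * (d * w)⁻¹ ∈ Subgroup.closure (cs.simple '' I) := by
    convert mul_mem (mul_mem hd hxI) (inv_mem hd) using 1
    group
  have hr1 : d * w * cs.simple x * (d * w)⁻¹ ≠ 1 := by
    intro h
    rw [conj_eq_one_iff] at h
    have := cs.length_simple x
    rw [h, cs.length_one] at this
    omega
  obtain ⟨c, hc, hcr⟩ := cs.exists_invParity_ne_zero_of_mem_closure hr hr1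
  refine ⟨c, hc, ?_⟩
  have hcI : cs.simple c ∈ Subgroup.closure (cs.simple '' I) :=
    Subgroup.subset_closure ⟨c, hc, rfl⟩
  have e1 := cs.invParity_mul (d * w * cs.simple x * (d * w)⁻¹) (d * w)
    ((d * w)⁻¹ * cs.simple c * (d * w))
  have e2 := cs.invParity_mul (d * w) (cs.simple x) ((d * w)⁻¹ * cs.simple c * (d * w))
  rw [hmin _ hcI, zero_add] at e1
  rw [show d * w * ((d * w)⁻¹ * cs.simple c * (d * w)) * (d * w)⁻¹ = cs.simple c by group,
    inv_mul_cancel_right, e2, cs.invParity_simple] at e1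
  have e3 := hmin _ (mul_mem (mul_mem hr hcI) (inv_mem hr))
  rw [show (d * w)⁻¹ * (d * w * cs.simple x * (d * w)⁻¹ * cs.simple c *
      (d * w * cs.simple x * (d * w)⁻¹)⁻¹) * (d * w) =
      cs.simple x * ((d * w)⁻¹ * cs.simple c * (d * w)) * (cs.simple x)⁻¹ by group] at e3
  rw [e3, add_zero] at e1
  rw [← e1] at hcr
  have : (d * w)⁻¹ * cs.simple c * (d * w) = cs.simple x := by
    by_contra h; exact hcr (if_neg h)
  rw [← this]
  group

/-- The shortest dw in W_{i,j} w carries s_x, s_y to two distinct simple reflections, so to s_i and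
s_j in some order. Since w = d⁻¹(dw) has no descent at x or y, d⁻¹ has none at i or j, hence d = 1.
-/
theorem conj_simple_eq_of_mem_minReps {X : Set B} {w : W} (hw : w ∈ cs.minReps X) {i j x y : B}
    (hx : x ∈ X) (hy : y ∈ X) (hxy : x ≠ y)
    (hxI : w * cs.simple x * w⁻¹ ∈ Subgroup.closure (cs.simple '' {i, j}))
    (hyI : w * cs.simple y * w⁻¹ ∈ Subgroup.closure (cs.simple '' {i, j})) :
    (w * cs.simple x * w⁻¹ = cs.simple i ∧ w * cs.simple y * w⁻¹ = cs.simple j) ∨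
      (w * cs.simple x * w⁻¹ = cs.simple j ∧ w * cs.simple y * w⁻¹ = cs.simple i) := by
  obtain ⟨d, hd, hmin, hX⟩ := cs.exists_minimal_mul_left X {i, j} w
  obtain ⟨a, ha, hxa⟩ := hX x hx hxI
  obtain ⟨b, hb, hyb⟩ := hX y hy hyI
  have hab : a ≠ b := by
    rintro rfl
    rw [← hyb] at hxa
    exact hxy (cs.simple_injective (mul_left_cancel (mul_right_cancel hxa)))
  have key : ∀ c ∈ ({i, j} : Set B), ∀ z ∈ X,
      d * w * cs.simple z * (d * w)⁻¹ = cs.simple c → cs.invParity d⁻¹ (cs.simple c) = 0 := by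
    intro c hc z hz e
    have h1 := cs.invParity_mul d⁻¹ (d * w) (cs.simple z)
    have h2 := hmin _ (Subgroup.subset_closure ⟨c, hc, rfl⟩)
    rw [← e, show (d * w)⁻¹ * (d * w * cs.simple z * (d * w)⁻¹) * (d * w) = cs.simple z by group]
      at h2
    rw [inv_mul_cancel_left, hw z hz, h2, zero_add, e] at h1
    exact h1.symm
  have hd1 : d = 1 := by
    by_contra hne
    obtain ⟨c, hc, hc0⟩ := cs.exists_invParity_ne_zero_of_mem_closure (inv_mem hd)
      (inv_ne_one.2 hne)
    have : c = a ∨ c = b := by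
      rcases ha with rfl | rfl <;> rcases hb with rfl | rfl <;> rcases hc with rfl | rfl <;> simp_all
    rcases this with rfl | rfl
    · exact hc0 (key _ hc x hx hxa)
    · exact hc0 (key _ hc y hy hyb)
  subst hd1
  rw [one_mul] at hxa hyb
  rcases ha with rfl | rfl <;> rcases hb with rfl | rfl
  · exact absurd rfl hab
  · exact Or.inl ⟨hxa, hyb⟩
  · exact Or.inr ⟨hxa, hyb⟩
  · exact absurd rfl hab

end CoxeterSystem

/-! ### Alternating products -/

section AlternatingProducts

variable {G : Type*} [Group G]

/-- The product `⋯ a b a` with `n` factors, alternating between `a` and `b`, with last factor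
`a`. -/
def altProd (a b : G) : ℕ → G
  | 0 => 1
  | n + 1 => (if Even n then a else b) * altProd a b n

theorem altProd_succ' (a b : G) (n : ℕ) : altProd a b (n + 1) = altProd b a n * a := by
  induction n with
  | zero => simp [altProd]
  | succ n ih =>
    rw [altProd, ih, altProd, mul_assoc]
    simp only [Nat.even_add_one, ite_not]

theorem altProd_inv_mul_altProd {a b : G} (ha : a⁻¹ = a) (hb : b⁻¹ = b) (n : ℕ) :
    (altProd b a n)⁻¹ * altProd a b n = (b * a) ^ n := by
  induction n generalizing a b with
  | zero => simp [altProd]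
  | succ n ih =>
    rw [altProd_succ', altProd_succ', mul_inv_rev, hb]
    calc _ = b * ((altProd a b n)⁻¹ * altProd b a n) * a := by simp only [mul_assoc]
      _ = _ := by rw [ih hb ha, ← mul_pow_mul, pow_succ, mul_assoc]

/-- This is the inversion contributed by the next letter added on the left of an alternating word.
-/
theorem altProd_conj {a b : G} (ha : a⁻¹ = a) (hb : b⁻¹ = b) (n : ℕ) :
    (altProd a b n)⁻¹ * (if Even n then a else b) * altProd a b n = (a * b) ^ n * a := by
  induction n generalizing a b with
  | zero => simp [altProd]
  | succ n ih =>
    have := ih hb ha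
    rw [altProd_succ', mul_inv_rev, ha]
    simp only [Nat.even_add_one, ite_not]
    calc _ = a * ((altProd b a n)⁻¹ * (if Even n then b else a) * altProd b a n) * a := by
          simp only [mul_assoc]
      _ = _ := by
        rw [this, pow_succ', mul_assoc a b, ← mul_pow_mul]

theorem map_altProd {H : Type*} [Group H] (φ : G →* H) (a b : G) (n : ℕ) :
    φ (altProd a b n) = altProd (φ a) (φ b) n := by
  induction n with
  | zero => simp [altProd]
  | succ n ih => rw [altProd, altProd, map_mul, ih]; split_ifs <;> rfl

theorem LabeledGraph.altWord_eq_altProd {V : Type*} (v w : V) (n : ℕ) :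
    LabeledGraph.altWord v w n = if Even n then altProd (.of w) (.of v) n
      else altProd (.of v) (.of w) n := by
  induction n generalizing v w with
  | zero => rfl
  | succ n ih =>
    rw [LabeledGraph.altWord, ih]
    by_cases h : Even n <;> simp [h, altProd, Nat.even_add_one]

end AlternatingProducts


/-- `altWord` fixes the first letter and `altProd` the last, so for even n the two sides of a braid
relation are exchanged. -/
theorem altProd_eq_iff_alternating {G : Type*} [Group G] (a b : G) (n : ℕ) :
    (if Even n then altProd b a n else altProd a b n) =
      (if Even n then altProd a b n else altProd b a n) ↔ altProd a b n = altProd b a n := by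
  split_ifs
  · exact eq_comm
  · rfl

/-! ### The Artin group and its Coxeter system -/

namespace LabeledGraph

variable {V : Type u} (Γ : LabeledGraph V)

open Classical in
/-- The Coxeter matrix of a labeled graph, with entry `0` (that is, `∞`) at the non-edges. -/
noncomputable def coxeterMatrix : CoxeterMatrix V where
  M := Matrix.of fun v w => if v = w then 1 else
    if h : s(v, w) ∈ Γ.graph.edgeSet then Γ.label ⟨s(v, w), h⟩ else 0
  isSymm := by
    ext v w
    simp only [Matrix.transpose_apply, Matrix.of_apply, Sym2.eq_swap (a := w), eq_comm (a := w)]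
  diagonal v := by simp
  off_diagonal v w hvw := by
    simp only [Matrix.of_apply, hvw, if_false]
    split_ifs with h
    · have := Γ.two_le_label ⟨s(v, w), h⟩
      omega
    · exact zero_ne_one

theorem ne_of_edge {v w : V} (h : s(v, w) ∈ Γ.graph.edgeSet) : v ≠ w :=
  SimpleGraph.Adj.ne (G := Γ.graph) h

open Classical in
theorem coxeterMatrix_of_edge {v w : V} (h : s(v, w) ∈ Γ.graph.edgeSet) :
    Γ.coxeterMatrix v w = Γ.label ⟨s(v, w), h⟩ := by
  change (if v = w then 1 else _) = _
  rw [if_neg (Γ.ne_of_edge h), dif_pos h]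

open Classical in
theorem edge_of_coxeterMatrix_ne_zero {v w : V} (hvw : v ≠ w) (h : Γ.coxeterMatrix v w ≠ 0) :
    s(v, w) ∈ Γ.graph.edgeSet := by
  by_contra hn
  apply h
  change (if v = w then 1 else _) = _
  rw [if_neg hvw, dif_neg hn]

theorem altProd_artinGen_eq {v w : V} (hvw : v ≠ w) :
    altProd (Γ.artinGen v) (Γ.artinGen w) (Γ.coxeterMatrix v w) =
      altProd (Γ.artinGen w) (Γ.artinGen v) (Γ.coxeterMatrix v w) := by
  by_cases h0 : Γ.coxeterMatrix v w = 0
  · rw [h0]; rfl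
  have h := Γ.edge_of_coxeterMatrix_ne_zero hvw h0
  rw [Γ.coxeterMatrix_of_edge h]
  have h1 : PresentedGroup.mk Γ.artinRelators (altWord v w (Γ.label ⟨s(v, w), h⟩) *
      (altWord w v (Γ.label ⟨s(v, w), h⟩))⁻¹) = 1 :=
    PresentedGroup.one_of_mem ⟨v, w, h, rfl⟩
  rw [map_mul, map_inv, mul_inv_eq_one, altWord_eq_altProd, altWord_eq_altProd] at h1
  simp only [apply_ite (PresentedGroup.mk Γ.artinRelators), map_altProd] at h1
  exact (altProd_eq_iff_alternating _ _ _).1 h1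

/-- The universal property of the Artin group in terms of alternating products. -/
noncomputable def artinLift {G : Type*} [Group G] (f : V → G)
    (hf : ∀ v w, s(v, w) ∈ Γ.graph.edgeSet →
      altProd (f v) (f w) (Γ.coxeterMatrix v w) = altProd (f w) (f v) (Γ.coxeterMatrix v w)) :
    Γ.ArtinGroup →* G :=
  PresentedGroup.toGroup (f := f) (by
    rintro _ ⟨v, w, h, rfl⟩
    rw [map_mul, map_inv, mul_inv_eq_one, altWord_eq_altProd, altWord_eq_altProd]
    simp only [apply_ite (FreeGroup.lift f), map_altProd, FreeGroup.lift_apply_of]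
    rw [altProd_eq_iff_alternating, ← Γ.coxeterMatrix_of_edge h]
    exact hf v w h)

theorem artinLift_artinGen {G : Type*} [Group G] (f : V → G) (hf) (v : V) :
    Γ.artinLift f hf (Γ.artinGen v) = f v :=
  PresentedGroup.toGroup.of _

theorem closure_range_artinGen : Subgroup.closure (Set.range Γ.artinGen) = ⊤ :=
  PresentedGroup.closure_range_of _

/-- The Coxeter group of a labeled graph, as a Coxeter system. -/
noncomputable def coxeterSystem : CoxeterSystem Γ.coxeterMatrix Γ.coxeterMatrix.Group :=
  Γ.coxeterMatrix.toCoxeterSystem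

/-- The shortest representatives of the left cosets of the standard parabolic subgroup of the
Coxeter group. -/
abbrev CosetRep (X : Set V) : Type u := Γ.coxeterSystem.minReps X

end LabeledGraph

/-! ### The generator steps and their braid relations -/

namespace LabeledGraph

variable {V : Type u} (Γ : LabeledGraph V)

/-- The emission condition is the same at w and at s_v w, so the non-emitting branch of the step is
its own inverse. -/
theorem exists_simple_mul_simple_mul_eq_iff (X : Set V) (v : V) (w : Γ.coxeterMatrix.Group) :
    (∃ x ∈ X, Γ.coxeterSystem.simple v * (Γ.coxeterSystem.simple v * w) =
      Γ.coxeterSystem.simple v * w * Γ.coxeterSystem.simple x) ↔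
    ∃ x ∈ X, Γ.coxeterSystem.simple v * w = w * Γ.coxeterSystem.simple x := by
  refine exists_congr fun x => and_congr_right fun _ => ?_
  rw [CoxeterSystem.simple_mul_simple_cancel_left, ← mul_inv_eq_iff_eq_mul,
    CoxeterSystem.inv_simple, eq_comm]

open Classical in
/-- The action of a standard generator on pairs consisting of a shortest coset representative and
an element of the Artin group. -/
noncomputable def retractStep (X : Set V) (v : V) : Equiv.Perm (Γ.CosetRep X × Γ.ArtinGroup) where
  toFun p := if h : ∃ x ∈ X, Γ.coxeterSystem.simple v * p.1 = p.1 * Γ.coxeterSystem.simple x then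
    (p.1, Γ.artinGen h.choose * p.2) else
    (⟨_, Γ.coxeterSystem.simple_mul_mem_minReps p.1.2 h⟩, p.2)
  invFun p := if h : ∃ x ∈ X, Γ.coxeterSystem.simple v * p.1 = p.1 * Γ.coxeterSystem.simple x then
    (p.1, (Γ.artinGen h.choose)⁻¹ * p.2) else
    (⟨_, Γ.coxeterSystem.simple_mul_mem_minReps p.1.2 h⟩, p.2)
  left_inv p := by
    by_cases h : ∃ x ∈ X, Γ.coxeterSystem.simple v * p.1 = p.1 * Γ.coxeterSystem.simple x
    · simp only [dif_pos h, inv_mul_cancel_left, Prod.mk.eta]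
    · have h' := mt (Γ.exists_simple_mul_simple_mul_eq_iff X v p.1).1 h
      beta_reduce
      simp only [dif_neg h]
      rw [dif_neg h']
      simp only [CoxeterSystem.simple_mul_simple_cancel_left, Subtype.coe_eta, Prod.mk.eta]
  right_inv p := by
    by_cases h : ∃ x ∈ X, Γ.coxeterSystem.simple v * p.1 = p.1 * Γ.coxeterSystem.simple x
    · simp only [dif_pos h, mul_inv_cancel_left, Prod.mk.eta]
    · have h' := mt (Γ.exists_simple_mul_simple_mul_eq_iff X v p.1).1 h
      beta_reduce
      simp only [dif_neg h]
      rw [dif_neg h']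
      simp only [CoxeterSystem.simple_mul_simple_cancel_left, Subtype.coe_eta, Prod.mk.eta]

variable {Γ} {X : Set V}

open Classical in
theorem retractStep_of_eq {v x : V} (p : Γ.CosetRep X × Γ.ArtinGroup) (hx : x ∈ X)
    (h : Γ.coxeterSystem.simple v * p.1 = p.1 * Γ.coxeterSystem.simple x) :
    Γ.retractStep X v p = (p.1, Γ.artinGen x * p.2) := by
  have hex : ∃ x ∈ X, Γ.coxeterSystem.simple v * p.1 = p.1 * Γ.coxeterSystem.simple x :=
    ⟨x, hx, h⟩
  have : hex.choose = x := Γ.coxeterSystem.simple_injective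
    (mul_left_cancel (hex.choose_spec.2.symm.trans h))
  change dite _ _ _ = _
  rw [dif_pos hex, this]

theorem retractStep_of_not {v : V} (p : Γ.CosetRep X × Γ.ArtinGroup)
    (h : ¬∃ x ∈ X, Γ.coxeterSystem.simple v * p.1 = p.1 * Γ.coxeterSystem.simple x) :
    Γ.retractStep X v p = (⟨_, Γ.coxeterSystem.simple_mul_mem_minReps p.1.2 h⟩, p.2) :=
  dif_neg h

theorem ite_mem_pair (i j : V) (n : ℕ) : (if Even n then i else j) ∈ ({i, j} : Set V) := by
  split_ifs <;> simp

theorem altProd_simple_mem (i j : V) (n : ℕ) :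
    altProd (Γ.coxeterSystem.simple i) (Γ.coxeterSystem.simple j) n ∈
      Subgroup.closure (Γ.coxeterSystem.simple '' {i, j}) := by
  induction n with
  | zero => exact one_mem _
  | succ n ih =>
    rw [altProd, ← apply_ite Γ.coxeterSystem.simple]
    exact mul_mem (Subgroup.subset_closure ⟨_, ite_mem_pair i j n, rfl⟩) ih

open Classical in
/-- Along an alternating product, if at most one element `x` of `X` can be emitted, it is emitted
once for each occurrence of its conjugate among the inversions. -/
theorem altProd_retractStep_apply {i j x : V} (p : Γ.CosetRep X × Γ.ArtinGroup)
    (H : ∀ y ∈ X, (p.1 : Γ.coxeterMatrix.Group) * Γ.coxeterSystem.simple y * (p.1 : Γ.coxeterMatrix.Group)⁻¹ ∈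
      Subgroup.closure (Γ.coxeterSystem.simple '' {i, j}) → y = x) (n : ℕ) :
    let N := ((Finset.range n).filter fun l => x ∈ X ∧
      (Γ.coxeterSystem.simple i * Γ.coxeterSystem.simple j) ^ l * Γ.coxeterSystem.simple i =
        p.1 * Γ.coxeterSystem.simple x * (p.1 : Γ.coxeterMatrix.Group)⁻¹).card
    ((altProd (Γ.retractStep X i) (Γ.retractStep X j) n p).1 : Γ.coxeterMatrix.Group) =
      altProd (Γ.coxeterSystem.simple i) (Γ.coxeterSystem.simple j) n * p.1 *
        Γ.coxeterSystem.simple x ^ N ∧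
    (altProd (Γ.retractStep X i) (Γ.retractStep X j) n p).2 = Γ.artinGen x ^ N * p.2 ∧
    (N ≠ 0 → (p.1 : Γ.coxeterMatrix.Group) * Γ.coxeterSystem.simple x *
      (p.1 : Γ.coxeterMatrix.Group)⁻¹ ∈ Subgroup.closure (Γ.coxeterSystem.simple '' {i, j})) := by
  induction n with
  | zero => simp [altProd]
  | succ n ih =>
    obtain ⟨w, a⟩ := p
    simp only at H ih ⊢
    rw [Finset.range_add_one, Finset.filter_insert]
    set F := (Finset.range n).filter fun l => x ∈ X ∧
      (Γ.coxeterSystem.simple i * Γ.coxeterSystem.simple j) ^ l * Γ.coxeterSystem.simple i =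
        w * Γ.coxeterSystem.simple x * (w : Γ.coxeterMatrix.Group)⁻¹ with hF
    have hnF : n ∉ F := by simp [hF]
    obtain ⟨ih1, ih2, ih3⟩ := ih
    have ht : (altProd (Γ.coxeterSystem.simple i) (Γ.coxeterSystem.simple j) n)⁻¹ *
        Γ.coxeterSystem.simple (if Even n then i else j) *
        altProd (Γ.coxeterSystem.simple i) (Γ.coxeterSystem.simple j) n =
          (Γ.coxeterSystem.simple i * Γ.coxeterSystem.simple j) ^ n *
            Γ.coxeterSystem.simple i := by
      rw [apply_ite Γ.coxeterSystem.simple]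
      exact altProd_conj (Γ.coxeterSystem.inv_simple i) (Γ.coxeterSystem.inv_simple j) n
    have hPI := altProd_simple_mem (Γ := Γ) i j n
    have hcI : Γ.coxeterSystem.simple (if Even n then i else j) ∈
        Subgroup.closure (Γ.coxeterSystem.simple '' {i, j}) :=
      Subgroup.subset_closure ⟨_, ite_mem_pair i j n, rfl⟩
    have htI := mul_mem (mul_mem (inv_mem hPI) hcI) hPI
    rw [altProd, altProd, ← apply_ite Γ.coxeterSystem.simple, ← apply_ite (Γ.retractStep X),
      Equiv.Perm.mul_apply]
    set c := if Even n then i else j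
    set P := altProd (Γ.coxeterSystem.simple i) (Γ.coxeterSystem.simple j) n
    set q := altProd (Γ.retractStep X i) (Γ.retractStep X j) n (w, a)
    set t := (Γ.coxeterSystem.simple i * Γ.coxeterSystem.simple j) ^ n * Γ.coxeterSystem.simple i
    -- The current representative is P w s_x^N and t is the next inversion, so s_x is emitted
    -- exactly when t = w s_x w⁻¹.
    have hcP : Γ.coxeterSystem.simple c * P = P * t := by rw [← ht]; group
    rw [ht] at htI
    by_cases h : x ∈ X ∧ t = w * Γ.coxeterSystem.simple x * (w : Γ.coxeterMatrix.Group)⁻¹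
    · rw [if_pos h, Finset.card_insert_of_notMem hnF]
      have h1 : Γ.coxeterSystem.simple c * q.1 = q.1 * Γ.coxeterSystem.simple x := by
        rw [ih1, ← mul_assoc, ← mul_assoc, hcP, h.2, mul_assoc _ _ (Γ.coxeterSystem.simple x),
          ← pow_succ, pow_succ']
        group
      rw [retractStep_of_eq q h.1 h1]
      refine ⟨?_, ?_, fun _ => h.2 ▸ htI⟩
      · rw [hcP, h.2, ih1, pow_succ']
        have := Γ.coxeterSystem.simple_mul_simple_self x
        simp only [mul_assoc, inv_mul_cancel, mul_one]
        simp
      · rw [ih2, pow_succ', mul_assoc]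
    · rw [if_neg h]
      have h1 : ¬∃ y ∈ X, Γ.coxeterSystem.simple c * q.1 = q.1 * Γ.coxeterSystem.simple y := by
        rintro ⟨y, hy, e⟩
        rw [ih1, ← mul_assoc, ← mul_assoc, hcP] at e
        have e' : t = (w * Γ.coxeterSystem.simple x * (w : Γ.coxeterMatrix.Group)⁻¹) ^ F.card *
            (w * Γ.coxeterSystem.simple y * (w : Γ.coxeterMatrix.Group)⁻¹) *
            ((w * Γ.coxeterSystem.simple x * (w : Γ.coxeterMatrix.Group)⁻¹) ^ F.card)⁻¹ := by
          rw [conj_pow]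
          simp only [mul_assoc, mul_left_cancel_iff] at e
          simp only [mul_assoc, mul_inv_rev, inv_inv, inv_mul_cancel_left]
          rw [← mul_assoc t, ← eq_mul_inv_iff_mul_eq, ← eq_mul_inv_iff_mul_eq] at e
          rw [e]
          simp only [mul_assoc]
        -- Earlier emissions put w s_x w⁻¹ in the dihedral group; this is why the induction carries
        -- its third clause. Undoing the conjugation then puts w s_y w⁻¹ there too, so y = x by `H`.
        have hz : (w * Γ.coxeterSystem.simple x * (w : Γ.coxeterMatrix.Group)⁻¹) ^ F.card ∈
            Subgroup.closure (Γ.coxeterSystem.simple '' {i, j}) := by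
          by_cases h0 : F.card = 0
          · rw [h0, pow_zero]; exact one_mem _
          · exact pow_mem (ih3 h0) _
        have hyx : y = x := H y hy (by
          have := mul_mem (mul_mem (inv_mem hz) htI) hz
          rw [e'] at this
          convert this using 1
          group)
        subst hyx
        refine h ⟨hy, ?_⟩
        rw [e', ← pow_succ, pow_succ', mul_inv_cancel_right]
      rw [retractStep_of_not q h1]
      refine ⟨?_, ih2, ih3⟩
      change _ * _ = _
      rw [ih1]
      simp only [mul_assoc]

theorem altProd_fixed {Y G : Type*} [Group G] (f g : Equiv.Perm (Y × G)) (w : Y) (a b : G)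
    (hf : ∀ c, f (w, c) = (w, a * c)) (hg : ∀ c, g (w, c) = (w, b * c)) (n : ℕ) (c : G) :
    altProd f g n (w, c) = (w, altProd a b n * c) := by
  induction n with
  | zero => simp [altProd]
  | succ n ih =>
    rw [altProd, altProd, Equiv.Perm.mul_apply, ih]
    split_ifs <;> simp [hf, hg, mul_assoc]

end LabeledGraph

theorem altProd_comm_of_pow_eq_one {G : Type*} [Group G] {a b : G} (ha : a⁻¹ = a) (hb : b⁻¹ = b)
    {n : ℕ} (h : (b * a) ^ n = 1) : altProd a b n = altProd b a n := by
  have := altProd_inv_mul_altProd ha hb n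
  rw [h, inv_mul_eq_one] at this
  exact this.symm

/-- The two alternating words of a braid relation have the same inversions, listed in opposite
orders. -/
theorem mul_pow_mul_sub_one {G : Type*} [Group G] {a b : G} (ha : a⁻¹ = a) (hb : b⁻¹ = b)
    {n l : ℕ} (h : (a * b) ^ n = 1) (hl : l < n) :
    (a * b) ^ (n - 1 - l) * a = (b * a) ^ l * b := by
  have h1 : (a * b) ^ (n - 1 - l) * (a * b) ^ (l + 1) = 1 := by
    rw [← pow_add, show n - 1 - l + (l + 1) = n by omega, h]
  have h2 : ((a * b) ^ (l + 1))⁻¹ = (b * a) ^ (l + 1) := by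
    rw [← inv_pow, mul_inv_rev, ha, hb]
  rw [eq_inv_of_mul_eq_one_left h1, h2, pow_succ, mul_assoc, mul_assoc]
  nth_rw 2 [← ha]
  simp

namespace LabeledGraph

variable {V : Type u} {Γ : LabeledGraph V} {X : Set V}

-- Both words emit only x, and equally often, because their lists of inversions are reversals of
-- each other.
open Classical in
theorem altProd_retractStep_comm_of_unique {i j x : V} (p : Γ.CosetRep X × Γ.ArtinGroup)
    (H : ∀ y ∈ X, (p.1 : Γ.coxeterMatrix.Group) * Γ.coxeterSystem.simple y *
      (p.1 : Γ.coxeterMatrix.Group)⁻¹ ∈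
        Subgroup.closure (Γ.coxeterSystem.simple '' {i, j}) → y = x) :
    altProd (Γ.retractStep X i) (Γ.retractStep X j) (Γ.coxeterMatrix i j) p =
      altProd (Γ.retractStep X j) (Γ.retractStep X i) (Γ.coxeterMatrix i j) p := by
  have h1 := altProd_retractStep_apply p H (Γ.coxeterMatrix i j)
  have h2 := altProd_retractStep_apply (i := j) (j := i) p (by rwa [Set.pair_comm])
    (Γ.coxeterMatrix i j)
  have hi := Γ.coxeterSystem.inv_simple i
  have hj := Γ.coxeterSystem.inv_simple j
  have hP := altProd_comm_of_pow_eq_one hi hj (Γ.coxeterSystem.simple_mul_simple_pow' i j)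
  have hN : ((Finset.range (Γ.coxeterMatrix i j)).filter fun l => x ∈ X ∧
      (Γ.coxeterSystem.simple i * Γ.coxeterSystem.simple j) ^ l * Γ.coxeterSystem.simple i =
        p.1 * Γ.coxeterSystem.simple x * (p.1 : Γ.coxeterMatrix.Group)⁻¹).card =
      ((Finset.range (Γ.coxeterMatrix i j)).filter fun l => x ∈ X ∧
      (Γ.coxeterSystem.simple j * Γ.coxeterSystem.simple i) ^ l * Γ.coxeterSystem.simple j =
        p.1 * Γ.coxeterSystem.simple x * (p.1 : Γ.coxeterMatrix.Group)⁻¹).card := by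
    rw [Finset.card_filter, Finset.card_filter, ← Finset.sum_range_reflect]
    refine Finset.sum_congr rfl fun l hl => ?_
    rw [mul_pow_mul_sub_one hi hj (Γ.coxeterSystem.simple_mul_simple_pow i j)
      (Finset.mem_range.1 hl)]
  refine Prod.ext (Subtype.ext ?_) ?_
  · rw [h1.1, h2.1, hP, hN]
  · rw [h1.2.1, h2.2.1, hN]

/-- Both steps fix w and multiply by the generators of x and y. Conjugation by w preserves orders,
so m(x, y) = m(i, j) and the braid relation of x and y in A applies. -/
theorem altProd_retractStep_comm_of_conj {i j x y : V} (hij : i ≠ j)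
    (p : Γ.CosetRep X × Γ.ArtinGroup) (hx : x ∈ X) (hy : y ∈ X)
    (hxi : (p.1 : Γ.coxeterMatrix.Group) * Γ.coxeterSystem.simple x *
      (p.1 : Γ.coxeterMatrix.Group)⁻¹ = Γ.coxeterSystem.simple i)
    (hyj : (p.1 : Γ.coxeterMatrix.Group) * Γ.coxeterSystem.simple y *
      (p.1 : Γ.coxeterMatrix.Group)⁻¹ = Γ.coxeterSystem.simple j) :
    altProd (Γ.retractStep X i) (Γ.retractStep X j) (Γ.coxeterMatrix i j) p =
      altProd (Γ.retractStep X j) (Γ.retractStep X i) (Γ.coxeterMatrix i j) p := by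
  obtain ⟨w, a⟩ := p
  have hM : Γ.coxeterMatrix i j = Γ.coxeterMatrix x y := by
    rw [← Γ.coxeterSystem.orderOf_simple_mul_simple, ← Γ.coxeterSystem.orderOf_simple_mul_simple,
      ← hxi, ← hyj, conj_mul]
    exact MulEquiv.orderOf_eq (MulAut.conj (w : Γ.coxeterMatrix.Group)) _
  have hxy : x ≠ y := by
    rintro rfl
    exact hij (Γ.coxeterSystem.simple_injective (hxi.symm.trans hyj))
  have hi : ∀ c, Γ.retractStep X i (w, c) = (w, Γ.artinGen x * c) := fun c =>
    retractStep_of_eq (w, c) hx (mul_inv_eq_iff_eq_mul.1 hxi).symm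
  have hj : ∀ c, Γ.retractStep X j (w, c) = (w, Γ.artinGen y * c) := fun c =>
    retractStep_of_eq (w, c) hy (mul_inv_eq_iff_eq_mul.1 hyj).symm
  rw [altProd_fixed _ _ w _ _ hi hj, altProd_fixed _ _ w _ _ hj hi, hM, Γ.altProd_artinGen_eq hxy]

theorem altProd_retractStep_comm (X : Set V) {i j : V} (hij : i ≠ j) :
    altProd (Γ.retractStep X i) (Γ.retractStep X j) (Γ.coxeterMatrix i j) =
      altProd (Γ.retractStep X j) (Γ.retractStep X i) (Γ.coxeterMatrix i j) := by
  ext1 p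
  by_cases H : ∃ x, ∀ y ∈ X, (p.1 : Γ.coxeterMatrix.Group) * Γ.coxeterSystem.simple y *
      (p.1 : Γ.coxeterMatrix.Group)⁻¹ ∈
        Subgroup.closure (Γ.coxeterSystem.simple '' {i, j}) → y = x
  · obtain ⟨x, hx⟩ := H
    exact altProd_retractStep_comm_of_unique p hx
  · push Not at H
    -- The vertex `i` is an arbitrary argument, used only to get some x; applying `H` to x then
    -- gives a second, different y.
    obtain ⟨x, hx, hxI, -⟩ := H i
    obtain ⟨y, hy, hyI, hyx⟩ := H x
    rcases Γ.coxeterSystem.conj_simple_eq_of_mem_minReps p.1.2 hx hy hyx.symm hxI hyI with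
      ⟨h1, h2⟩ | ⟨h1, h2⟩
    · exact altProd_retractStep_comm_of_conj hij p hx hy h1 h2
    · exact altProd_retractStep_comm_of_conj hij p hy hx h2 h1

/-! ### The action of the Artin group and conjugation into a standard parabolic subgroup -/

variable (Γ) (X)

/-- The action of the Artin group on pairs consisting of a shortest coset representative and an
element of the Artin group; the second component of the orbit map of `(1, 1)` is a set-theoretic
retraction onto the standard parabolic subgroup. -/
noncomputable def retractAction : Γ.ArtinGroup →* Equiv.Perm (Γ.CosetRep X × Γ.ArtinGroup) :=
  Γ.artinLift (Γ.retractStep X) fun _ _ h => altProd_retractStep_comm X (Γ.ne_of_edge h)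

theorem retractAction_artinGen (v : V) :
    Γ.retractAction X (Γ.artinGen v) = Γ.retractStep X v :=
  Γ.artinLift_artinGen _ _ v

variable {Γ} in
theorem artin_induction {P : Γ.ArtinGroup → Prop} (gen : ∀ v, P (Γ.artinGen v)) (one : P 1)
    (mul : ∀ a b, P a → P b → P (a * b)) (inv : ∀ a, P a → P a⁻¹) (g : Γ.ArtinGroup) : P g := by
  have hg : g ∈ Subgroup.closure (Set.range Γ.artinGen) := by
    rw [closure_range_artinGen]; exact Subgroup.mem_top g
  induction hg using Subgroup.closure_induction with
  | mem x hx => obtain ⟨v, rfl⟩ := hx; exact gen v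
  | one => exact one
  | mul a b _ _ ha hb => exact mul a b ha hb
  | inv a _ ha => exact inv a ha

theorem retractAction_mul_right (g b : Γ.ArtinGroup) (p : Γ.CosetRep X × Γ.ArtinGroup) :
    Γ.retractAction X g (p.1, p.2 * b) =
      ((Γ.retractAction X g p).1, (Γ.retractAction X g p).2 * b) := by
  induction g using artin_induction generalizing p with
  | gen v =>
    rw [retractAction_artinGen]
    by_cases h : ∃ x ∈ X, Γ.coxeterSystem.simple v * p.1 = p.1 * Γ.coxeterSystem.simple x
    · obtain ⟨x, hx, e⟩ := h
      rw [retractStep_of_eq p hx e, retractStep_of_eq (p.1, p.2 * b) hx e, mul_assoc]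
    · rw [retractStep_of_not p h, retractStep_of_not (p.1, p.2 * b) h]
  | one => simp
  | mul g h hg hh => rw [map_mul, Equiv.Perm.mul_apply, hh, hg]; rfl
  | inv g hg =>
    rw [map_inv, Equiv.Perm.inv_eq_iff_eq, hg, ← map_inv]
    simp

theorem retractAction_snd_mem (g : Γ.ArtinGroup) (p : Γ.CosetRep X × Γ.ArtinGroup) :
    (Γ.retractAction X g p).2 * p.2⁻¹ ∈ Γ.standardParabolic X := by
  induction g using artin_induction generalizing p with
  | gen v =>
    rw [retractAction_artinGen]
    by_cases h : ∃ x ∈ X, Γ.coxeterSystem.simple v * p.1 = p.1 * Γ.coxeterSystem.simple x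
    · obtain ⟨x, hx, e⟩ := h
      rw [retractStep_of_eq p hx e, mul_inv_cancel_right]
      exact Subgroup.subset_closure ⟨x, hx, rfl⟩
    · rw [retractStep_of_not p h, mul_inv_cancel]
      exact one_mem _
  | one => simp
  | mul g h hg hh =>
    rw [map_mul, Equiv.Perm.mul_apply]
    convert mul_mem (hg (Γ.retractAction X h p)) (hh p) using 1
    group
  | inv g hg =>
    have := inv_mem (hg (Γ.retractAction X g⁻¹ p))
    rw [← Equiv.Perm.mul_apply, ← map_mul, mul_inv_cancel, map_one, Equiv.Perm.one_apply] at this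
    simpa using this

/-- The base point of the action. -/
noncomputable def retractBase : Γ.CosetRep X := ⟨1, Γ.coxeterSystem.one_mem_minReps X⟩

theorem retractAction_base {a : Γ.ArtinGroup} (ha : a ∈ Γ.standardParabolic X) (c : Γ.ArtinGroup) :
    Γ.retractAction X a (Γ.retractBase X, c) = (Γ.retractBase X, a * c) := by
  induction ha using Subgroup.closure_induction generalizing c with
  | mem _ h =>
    obtain ⟨x, hx, rfl⟩ := h
    rw [retractAction_artinGen]
    exact retractStep_of_eq (Γ.retractBase X, c) hx (by simp [retractBase])
  | one => simp
  | mul a b _ _ ha hb => rw [map_mul, Equiv.Perm.mul_apply, hb, ha, mul_assoc]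
  | inv a _ ha => rw [map_inv, Equiv.Perm.inv_eq_iff_eq, ha, mul_inv_cancel_left]

/-- Here b is the A-component of g(1, 1), and f(y) is the letter that y emits there. Two vertices
with the same f(y) have the same s_y = w s_{f(y)} w⁻¹, whence injectivity. -/
theorem exists_conj_eq_conj_artinGen {g : Γ.ArtinGroup} {Y : Set V}
    (hY : ∀ y ∈ Y, g⁻¹ * Γ.artinGen y * g ∈ Γ.standardParabolic X) :
    ∃ b ∈ Γ.standardParabolic X, ∃ f : V → V, Set.MapsTo f Y X ∧ Set.InjOn f Y ∧
      ∀ y ∈ Y, g⁻¹ * Γ.artinGen y * g = b⁻¹ * Γ.artinGen (f y) * b := by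
  set q := Γ.retractAction X g (Γ.retractBase X, 1) with hq
  have hb : q.2 ∈ Γ.standardParabolic X := by
    simpa using Γ.retractAction_snd_mem X g (Γ.retractBase X, 1)
  have key : ∀ y ∈ Y, ∃ x ∈ X,
      Γ.coxeterSystem.simple y * q.1 = q.1 * Γ.coxeterSystem.simple x ∧
      g⁻¹ * Γ.artinGen y * g = q.2⁻¹ * Γ.artinGen x * q.2 := by
    intro y hy
    -- Write yg = g(g⁻¹yg): the right factor lies in A_X and acts on the base point by
    -- multiplication, which then passes through g.
    have h1 : Γ.retractStep X y q = (q.1, q.2 * (g⁻¹ * Γ.artinGen y * g)) := by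
      rw [← retractAction_artinGen, hq, ← Equiv.Perm.mul_apply, ← map_mul,
        show Γ.artinGen y * g = g * (g⁻¹ * Γ.artinGen y * g) by group, map_mul,
        Equiv.Perm.mul_apply, Γ.retractAction_base X (hY y hy), mul_one,
        ← Γ.retractAction_mul_right, one_mul]
    by_cases h : ∃ x ∈ X, Γ.coxeterSystem.simple y * q.1 = q.1 * Γ.coxeterSystem.simple x
    · obtain ⟨x, hx, e⟩ := h
      refine ⟨x, hx, e, ?_⟩
      rw [retractStep_of_eq q hx e] at h1
      have h2 : Γ.artinGen x * q.2 = q.2 * (g⁻¹ * Γ.artinGen y * g) := (Prod.ext_iff.1 h1).2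
      rw [mul_assoc q.2⁻¹, h2, inv_mul_cancel_left]
    · rw [retractStep_of_not q h] at h1
      have h2 : Γ.coxeterSystem.simple y * q.1 = q.1 :=
        congrArg Subtype.val (Prod.ext_iff.1 h1).1
      have h3 := Γ.coxeterSystem.length_simple y
      rw [mul_eq_right.1 h2, CoxeterSystem.length_one] at h3
      exact absurd h3 zero_ne_one
  choose! f hf hfs hfa using key
  refine ⟨q.2, hb, f, hf, fun y hy z hz e => ?_, hfa⟩
  have h1 := hfs y hy
  rw [e, ← hfs z hz, mul_right_cancel_iff] at h1
  exact Γ.coxeterSystem.simple_injective h1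

theorem parabolic_le_iff {X Y : Set V} {g h : Γ.ArtinGroup} :
    Γ.parabolic g Y ≤ Γ.parabolic h X ↔
      ∀ y ∈ Y, h⁻¹ * g * Γ.artinGen y * (h⁻¹ * g)⁻¹ ∈ Γ.standardParabolic X := by
  rw [parabolic, parabolic, Subgroup.map_le_iff_le_comap, standardParabolic, Subgroup.closure_le,
    Set.image_subset_iff]
  refine forall₂_congr fun y _ => ?_
  simp only [Set.mem_preimage, SetLike.mem_coe, Subgroup.mem_comap, Subgroup.mem_map,
    MulEquiv.toMonoidHom_eq_coe, MonoidHom.coe_coe, MulAut.conj_apply]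
  constructor
  · rintro ⟨a, ha, e⟩
    convert ha using 1
    rw [show h⁻¹ * g * Γ.artinGen y * (h⁻¹ * g)⁻¹ = h⁻¹ * (g * Γ.artinGen y * g⁻¹) * h by group,
      ← e]
    group
  · intro H
    exact ⟨_, H, by group⟩

end LabeledGraph

/-! ### The theorem -/

theorem mainTheorem2 {V : Type u} [Finite V] (Γ : LabeledGraph V) (g h : Γ.ArtinGroup)
    (Ω Δ : Set V) (hle : Γ.parabolic g Ω ≤ Γ.parabolic h Δ) :
    Ω.ncard ≤ Δ.ncard ∧ (Ω.ncard = Δ.ncard → Γ.parabolic g Ω = Γ.parabolic h Δ) := by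
  have hY : ∀ y ∈ Ω, (g⁻¹ * h)⁻¹ * Γ.artinGen y * (g⁻¹ * h) ∈ Γ.standardParabolic Δ := by
    simpa using Γ.parabolic_le_iff.1 hle
  obtain ⟨b, hb, f, hf, hinj, hfa⟩ := Γ.exists_conj_eq_conj_artinGen Δ hY
  have hcard := hinj.ncard_image
  refine ⟨hcard ▸ Set.ncard_le_ncard hf.image_subset, fun heq => le_antisymm hle ?_⟩
  have himg : f '' Ω = Δ := Set.eq_of_subset_of_ncard_le hf.image_subset (by rw [hcard, heq])
  set k := g⁻¹ * h with hk
  -- Every generator of A_Δ is some f(y) with y ∈ Ω, and conjugation by kb⁻¹ sends it back to y.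
  have hmem : ∀ a ∈ Γ.standardParabolic Δ, k * (b⁻¹ * a * b) * k⁻¹ ∈ Γ.standardParabolic Ω := by
    intro a ha
    induction ha using Subgroup.closure_induction with
    | mem _ hx =>
      obtain ⟨x, hx, rfl⟩ := hx
      rw [← himg] at hx
      obtain ⟨y, hy, rfl⟩ := hx
      rw [← hfa y hy]
      have hy' : Γ.artinGen y ∈ Γ.standardParabolic Ω := Subgroup.subset_closure ⟨y, hy, rfl⟩
      convert hy' using 1
      group
    | one => simp
    | mul a c _ _ ha hc =>
      convert mul_mem ha hc using 1
      group
    | inv a _ ha =>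
      convert inv_mem ha using 1
      group
  rw [Γ.parabolic_le_iff]
  intro x hx
  have hx' : Γ.artinGen x ∈ Γ.standardParabolic Δ := Subgroup.subset_closure ⟨x, hx, rfl⟩
  -- Since b ∈ A_Δ, the element bxb⁻¹ is an allowed argument, and it cancels the conjugation by b.
  convert hmem _ (mul_mem (mul_mem hb hx') (inv_mem hb)) using 1
  rw [hk]
  group
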